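/- Conventions. A collective risk model (CRM) $(N,\underline X)$ consists of a random variable $N$ with values in $\{0,1,2,\dots\}$ and a sequence $\underline X=(X_j)_{j\ge1}$ of identically distributed, almost surely strictly positive random variables, with any dependence; its aggregate claim amount is $S=\sum_{j=1}^{N}X_j$ ($S=0$ if $N=0$), and $A_N=\{k:\Pr(N=k)>0\}$ is the support of $N$. For $d\ge2$, the $d$-variate Farlie-Gumbel-Morgenstern (FGM) copula with real parameters $\theta=(\theta_A)$, indexed by the subsets $A$ of the $d$ indices with $|A|\ge2$, is $$C_\theta(u)=\prod_m u_m\Bigl(1+\sum_{|A|\ge2}\theta_A\prod_{j\in A}(1-u_j)\Bigr),\quad u\in[0,1]^d,$$ where $1+\sum_{|A|\ge2}\theta_A\prod_{j\in A}\varepsilon_j\ge0$ for all $\varepsilon\in\{-1,1\}^d$. The symmetric Bernoulli vector that corresponds to it takes the value $i\in\{0,1\}^d$ with probability $2^{-d}\bigl(1+\sum_{|A|\ge2}(-1)^{\sum_{j\in A}i_j}\theta_A\bigr)$. The CRM has full FGM dependence with underlying sequence $(I_j)_{j\ge0}$ of symmetric Bernoulli random variables (values in $\{0,1\}$, probability $1/2$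 each) if for every integer $k$ with $1\le k\le\sup A_N$ there is a $(k+1)$-variate FGM copula $C$ such that $$\Pr(N\le x_0,X_1\le x_1,\dots,X_k\le x_k)=C\bigl(F_N(x_0),F_X(x_1),\dots,F_X(x_k)\bigr)\quad\text{for all }x\in\mathbb R^{k+1}$$ and $(I_0,\dots,I_k)$ is distributed as the symmetric Bernoulli vector that corresponds to $C$. Here $F_N$ and $F_X$ are the cdfs of $N$ and of the $X_j$. A function $\phi:\mathbb R^d\to\mathbb R$ is supermodular if $\phi(x+\varepsilon e_i+\delta e_j)-\phi(x+\varepsilon e_i)\ge\phi(x+\delta e_j)-\phi(x)$ for all $x\in\mathbb R^d$, $i<j$ and $\varepsilon,\delta>0$. For $d$-dimensional random vectors, $V\preceq_{sm}V^\dagger$ means that $E[\phi(V)]\le E[\phi(V^\dagger)]$ for every supermodular $\phi$ for which both expectations exist, and for real random variables $Z\preceq_{icx}Z^\dagger$ means that $E[\phi(Z)]\le E[\phi(Z^\dagger)]$ for every nondecreasing convex $\phi:\mathbb R\to\mathbb R$ for which both expectations exist. (An expectation exists if the function is measurable for the completed law and its positive or its negative part has finite expectation; the value may be infinite.) Theorem.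 Let $(N,\underline X)$ and $(N^\dagger,\underline X^\dagger)$ be two CRMs with full FGM dependence, with the same marginal distributions ($F_N=F_{N^\dagger}$, $F_X=F_{X^\dagger}$), underlying symmetric Bernoulli sequences $(I_j)_{j\ge0}$ and $(I_j^\dagger)_{j\ge0}$, and aggregate claim amounts $S$ and $S^\dagger$. If $$(I_0,I_1,\dots,I_k)\preceq_{sm}(I_0^\dagger,I_1^\dagger,\dots,I_k^\dagger)\quad\text{for every integer }k\ge1,$$ then $$(N,X_1,\dots,X_k)\preceq_{sm}(N^\dagger,X_1^\dagger,\dots,X_k^\dagger)\quad\text{for every }k\in A_N,$$ and $S\preceq_{icx}S^\dagger$. -/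

import Mathlib

open MeasureTheory ProbabilityTheory

/-! ### Expectations and stochastic orders -/

/-- The expectation of `f` under `μ` exists (possibly with an infinite value): `f` is measurable with
respect to the completion of `μ`, and its positive or its negative part has a finite integral. -/
def HasExpectation {α : Type*} [MeasurableSpace α] (μ : Measure α) (f : α → ℝ) : Prop :=
  AEMeasurable f μ ∧
    ((∫⁻ x, ENNReal.ofReal (f x) ∂μ) ≠ ⊤ ∨ (∫⁻ x, ENNReal.ofReal (-f x) ∂μ) ≠ ⊤)

/-- The expectation `E[f⁺] - E[f⁻]` in `[-∞, ∞]`; meaningful when `HasExpectation μ f`. -/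
noncomputable def expectation {α : Type*} [MeasurableSpace α] (μ : Measure α) (f : α → ℝ) : EReal :=
  ((∫⁻ x, ENNReal.ofReal (f x) ∂μ : ENNReal) : EReal) -
    ((∫⁻ x, ENNReal.ofReal (-f x) ∂μ : ENNReal) : EReal)

/-- Supermodular functions on `ℝ^d`. -/
def Supermodular {d : ℕ} (φ : (Fin d → ℝ) → ℝ) : Prop :=
  ∀ (x : Fin d → ℝ) (i j : Fin d), i < j → ∀ ε δ : ℝ, 0 < ε → 0 < δ →
    φ (x + Pi.single j δ) - φ x ≤
      φ (x + Pi.single i ε + Pi.single j δ) - φ (x + Pi.single i ε)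

/-- The supermodular order between the laws `μ`, `ν` of two `d`-dimensional random vectors. -/
def SMOrder {d : ℕ} (μ ν : Measure (Fin d → ℝ)) : Prop :=
  ∀ φ : (Fin d → ℝ) → ℝ, Supermodular φ → HasExpectation μ φ → HasExpectation ν φ →
    expectation μ φ ≤ expectation ν φ

/-- The increasing convex order between the laws `μ`, `ν` of two real random variables. -/
def IcxOrder (μ ν : Measure ℝ) : Prop :=
  ∀ φ : ℝ → ℝ, Monotone φ → ConvexOn ℝ Set.univ φ → HasExpectation μ φ → HasExpectation ν φ →
    expectation μ φ ≤ expectation ν φ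

/-! ### Farlie-Gumbel-Morgenstern copulas and symmetric Bernoulli vectors -/

/-- `1 + ∑_{|A| ≥ 2} θ_A ∏_{j ∈ A} v_j`. -/
noncomputable def fgmPoly {d : ℕ} (θ : Finset (Fin d) → ℝ) (v : Fin d → ℝ) : ℝ :=
  1 + ∑ A : Finset (Fin d) with 2 ≤ A.card, θ A * ∏ j ∈ A, v j

/-- The set of parameters for which the FGM formula is a copula. Only the values of `θ` on sets
with at least two elements matter. -/
def FGMAdmissible {d : ℕ} (θ : Finset (Fin d) → ℝ) : Prop :=
  ∀ ε : Fin d → ℝ, (∀ j, ε j = 1 ∨ ε j = -1) → 0 ≤ fgmPoly θ ε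

/-- The `d`-variate FGM copula with parameters `θ`. -/
noncomputable def fgmCopula {d : ℕ} (θ : Finset (Fin d) → ℝ) (u : Fin d → ℝ) : ℝ :=
  (∏ m, u m) * fgmPoly θ (fun j => 1 - u j)

/-- The probability mass function on `{0,1}^d` of the symmetric Bernoulli vector that corresponds to
the FGM copula with parameters `θ`:
`2^{-d} (1 + ∑_{|A| ≥ 2} (-1)^{∑_{j ∈ A} i_j} θ_A)`. -/
noncomputable def fgmBernoulliPmf {d : ℕ} (θ : Finset (Fin d) → ℝ) (i : Fin d → Fin 2) : ℝ :=
  (1 / 2 ^ d) * (1 + ∑ A : Finset (Fin d) with 2 ≤ A.card, (-1) ^ (∑ j ∈ A, (i j : ℕ)) * θ A)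

/-- The joint cdf of `V` is the function `C` of its marginal cdfs. -/
def HasCopula {Ω : Type*} [MeasurableSpace Ω] (P : Measure Ω) {d : ℕ} (V : Ω → Fin d → ℝ)
    (C : (Fin d → ℝ) → ℝ) : Prop :=
  ∀ x : Fin d → ℝ, P.real {ω | ∀ i, V ω i ≤ x i} = C (fun i => P.real {ω | V ω i ≤ x i})

/-- `I` is a sequence of symmetric Bernoulli random variables (with any dependence). -/
structure IsSymmBernoulliSeq {Ω : Type*} [MeasurableSpace Ω] (Q : Measure Ω) (I : ℕ → Ω → ℝ) :
    Prop where
  measurable (j : ℕ) : Measurable (I j)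
  prob_zero (j : ℕ) : Q.real {ω | I j ω = 0} = 1 / 2
  prob_one (j : ℕ) : Q.real {ω | I j ω = 1} = 1 / 2

/-- The random vector `(I_0, …, I_k)`. -/
def initialVector {Ω : Type*} (I : ℕ → Ω → ℝ) (k : ℕ) (ω : Ω) : Fin (k + 1) → ℝ :=
  fun j => I j ω

/-! ### Collective risk models -/

/-- `n` is in the support of `N`. -/
def InSupport {Ω : Type*} [MeasurableSpace Ω] (P : Measure Ω) (N : Ω → ℕ) (n : ℕ) : Prop :=
  0 < P {ω | N ω = n}

/-- The random vector `(N, X_1, …, X_k)`; the claim amount `X_{j+1}` is `X j`. -/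
def crmVector {Ω : Type*} (N : Ω → ℕ) (X : ℕ → Ω → ℝ) (k : ℕ) (ω : Ω) : Fin (k + 1) → ℝ :=
  Fin.cons (N ω : ℝ) (fun j : Fin k => X j ω)

/-- The aggregate claim amount `S = X_1 + … + X_N` (`0` if `N = 0`). -/
noncomputable def aggregateClaim {Ω : Type*} (N : Ω → ℕ) (X : ℕ → Ω → ℝ) (ω : Ω) : ℝ :=
  ∑ j ∈ Finset.range (N ω), X j ω

/-- A collective risk model: a claim number `N` and identically distributed, strictly positive claim
amounts, with any dependence. -/
structure IsCRM {Ω : Type*} [MeasurableSpace Ω] (P : Measure Ω) (N : Ω → ℕ) (X : ℕ → Ω → ℝ) :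
    Prop where
  measurable_count : Measurable N
  measurable_amount (j : ℕ) : Measurable (X j)
  amount_pos (j : ℕ) : ∀ᵐ ω ∂P, 0 < X j ω
  identDistrib (i j : ℕ) : IdentDistrib (X i) (X j) P P

/-- A collective risk model with full FGM dependence, whose FGM copulas correspond to the symmetric
Bernoulli sequence `I`: for every `k ≥ 1` up to the supremum of the support of `N`, the vector
`(N, X_1, …, X_k)` has an FGM copula, and `(I_0, …, I_k)` is the symmetric Bernoulli vector that
corresponds to this copula. -/
structure IsFGMCRM {Ω Ω' : Type*} [MeasurableSpace Ω] [MeasurableSpace Ω'] (P : Measure Ω)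
    (N : Ω → ℕ) (X : ℕ → Ω → ℝ) (Q : Measure Ω') (I : ℕ → Ω' → ℝ) : Prop extends
    IsCRM P N X, IsSymmBernoulliSeq Q I where
  fgm (k : ℕ) : 1 ≤ k → (∃ n, k ≤ n ∧ InSupport P N n) →
    ∃ θ : Finset (Fin (k + 1)) → ℝ, FGMAdmissible θ ∧
      HasCopula P (crmVector N X k) (fgmCopula θ) ∧
      ∀ i : Fin (k + 1) → Fin 2,
        Q.real {ω | ∀ j, initialVector I k ω j = ((i j : ℕ) : ℝ)} = fgmBernoulliPmf θ i

/-!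
Let `(N, X_1, …, X_k)` have the FGM copula that corresponds to the symmetric Bernoulli vector
`(I_0, …, I_k)`. The cdf `u (1 + (1 - u))` is that of the minimum of two independent copies of a
variable with cdf `u`, and `u (1 - (1 - u))` that of their maximum. Expanding the copula along these
cdfs (`fgmCopula_eq_sum`, `map_eq_orderStatMixture`) shows that `(N, X_1, …, X_k)` has the law of
`a + (b - a) * I`, where `a ≤ b` are the minima and maxima of independent pairs of copies of the
marginals, independent of `I`. The pairs have the same law in both models.

For fixed `a ≤ b` and supermodular `φ`, the function `x ↦ φ (a + (b - a) * x)` is supermodular, so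
the order between the Bernoulli vectors gives an inequality for each `(a, b)`. Integrating it over
the pairs yields the supermodular order between the vectors (`smOrder_orderStatMixture`,
`smOrder_crmVector`). Expectations may be infinite here, and `φ` is measurable only for the
completed laws, so positive and negative parts are moved to opposite sides and integrated in `ENNReal`; the
result returns to `EReal` by `EReal.coe_ennreal_sub_le_sub`.

For the aggregate claim amount, `truncatedAggregate k` is a monotone supermodular function of
`(N, X_1, …, X_k)` whose value is `X_1 + … + X_{min N k}`, and a nondecreasing convex function of it
is again supermodular (`supermodular_convex_comp`). After subtraction of `φ 0`, all integrands are
nonnegative, and monotone convergence in `k` gives the increasing convex order. If the support of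
`N` is bounded, the sequence of truncations is eventually constant.
-/


/-! ### Differences of extended nonnegative reals -/

/-- Differences `E[f⁺] - E[f⁻]` in `EReal` can be compared without subtraction. Infinite values are
harmless: if `b = ⊤` the left side is `⊥`, and if `c = ⊤` then `d ≠ ⊤` and the right side is `⊤`. -/
theorem EReal.coe_ennreal_sub_le_sub {a b c d : ENNReal} (h : a + d ≤ c + b)
    (hcd : c ≠ ⊤ ∨ d ≠ ⊤) : (a : EReal) - b ≤ c - d := by
  by_cases hb : b = ⊤
  · simp [hb]
  by_cases hc : c = ⊤
  · have hd : (d : EReal) ≠ ⊤ := by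
      simpa using hcd.resolve_left (by simp [hc])
    rw [hc, EReal.coe_ennreal_top, EReal.top_sub hd]
    exact le_top
  have had : a + d ≠ ⊤ := ne_top_of_le_ne_top (ENNReal.add_ne_top.2 ⟨hc, hb⟩) h
  obtain ⟨ha, hd⟩ := ENNReal.add_ne_top.1 had
  lift a to NNReal using ha
  lift b to NNReal using hb
  lift c to NNReal using hc
  lift d to NNReal using hd
  have h' : (a : ℝ) + d ≤ c + b := by exact_mod_cast h
  have : (a : ℝ) - b ≤ c - d := by linarith
  simp only [EReal.coe_nnreal_eq_coe_real, ← EReal.coe_sub]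
  exact EReal.coe_le_coe_iff.2 this

/-! ### Order statistics of pairs and the mixture representation of FGM copulas -/

/-- A finite measure on `ℝ^d` is determined by its cdf. -/
theorem measure_pi_ext_of_Iic {d : ℕ} {μ ν : Measure (Fin d → ℝ)} [IsFiniteMeasure μ]
    (h : ∀ x : Fin d → ℝ, μ (Set.univ.pi fun m => Set.Iic (x m)) =
      ν (Set.univ.pi fun m => Set.Iic (x m))) :
    μ = ν := by
  have hgen : ∀ _ : Fin d, MeasurableSpace.generateFrom (Set.range (Set.Iic : ℝ → Set ℝ)) =
      (inferInstance : MeasurableSpace ℝ) := fun _ => by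
    rw [← borel_eq_generateFrom_Iic, BorelSpace.measurable_eq (α := ℝ)]
  have hspan : ∀ _ : Fin d, IsCountablySpanning (Set.range (Set.Iic : ℝ → Set ℝ)) := fun _ =>
    ⟨fun n => Set.Iic (n : ℝ), fun n => ⟨n, rfl⟩, Set.eq_univ_of_forall fun x =>
      Set.mem_iUnion.2 (exists_nat_ge x)⟩
  have hpi : IsPiSystem
      (Set.univ.pi '' Set.univ.pi fun _ : Fin d => Set.range (Set.Iic : ℝ → Set ℝ)) :=
    IsPiSystem.pi fun _ => by
      simpa only [Set.image_univ] using isPiSystem_image_Iic (Set.univ : Set ℝ)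
  refine Measure.ext_of_generateFrom_of_iUnion
    (Set.univ.pi '' Set.univ.pi fun _ : Fin d => Set.range (Set.Iic : ℝ → Set ℝ))
    (fun n : ℕ => Set.univ.pi fun _ : Fin d => Set.Iic (n : ℝ))
    (generateFrom_eq_pi hgen hspan).symm hpi ?_ ?_ (fun _ => measure_ne_top _ _) ?_
  · refine Set.eq_univ_of_forall fun x => Set.mem_iUnion.2 ?_
    obtain ⟨n, hn⟩ := exists_nat_ge (∑ m, |x m|)
    refine ⟨n, fun m _ => ?_⟩
    exact (le_abs_self _).trans ((Finset.single_le_sum (f := fun m => |x m|)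
      (fun i _ => abs_nonneg _) (Finset.mem_univ m)).trans hn)
  · exact fun n => ⟨fun _ => Set.Iic (n : ℝ), fun _ _ => ⟨n, rfl⟩, rfl⟩
  · rintro s ⟨t, ht, rfl⟩
    choose x hx using fun m => ht m (Set.mem_univ m)
    have : t = fun m => Set.Iic (x m) := funext fun m => (hx m).symm
    rw [this]
    exact h x

/-- The smaller (`b = 0`) or the larger (`b = 1`) component of a pair. -/
noncomputable def orderStat (b : Fin 2) (w : ℝ × ℝ) : ℝ :=
  if b = 0 then min w.1 w.2 else max w.1 w.2

theorem measurable_orderStat (b : Fin 2) : Measurable (orderStat b) := by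
  unfold orderStat
  split_ifs
  · exact measurable_fst.min measurable_snd
  · exact measurable_fst.max measurable_snd

/-- With `u = F x`, the minimum of two independent copies has cdf `u (1 + (1 - u)) = 1 - (1 - u)²`,
and the maximum has cdf `u (1 - (1 - u)) = u²`. -/
theorem prod_orderStat_le (μ : Measure ℝ) [IsProbabilityMeasure μ] (b : Fin 2) (x : ℝ) :
    (μ.prod μ).real {w | orderStat b w ≤ x} =
      μ.real (Set.Iic x) * (1 + (-1) ^ (b : ℕ) * (1 - μ.real (Set.Iic x))) := by
  fin_cases b
  · have hset : {w : ℝ × ℝ | orderStat 0 w ≤ x} = (Set.Ioi x ×ˢ Set.Ioi x)ᶜ := by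
      ext w
      simp only [orderStat, if_true, Set.mem_ofPred_eq, Set.mem_compl_iff, Set.mem_prod,
        Set.mem_Ioi, min_le_iff, not_and_or, not_lt]
    simp only [Fin.zero_eta, hset, pow_zero]
    rw [probReal_compl_eq_one_sub (measurableSet_Ioi.prod measurableSet_Ioi),
      measureReal_prod_prod, ← Set.compl_Iic, probReal_compl_eq_one_sub measurableSet_Iic]
    ring
  · have hset : {w : ℝ × ℝ | orderStat 1 w ≤ x} = Set.Iic x ×ˢ Set.Iic x := by
      ext w
      simp [orderStat, Prod.le_def]
    simp only [Fin.mk_one, hset, pow_one, measureReal_prod_prod]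
    ring

/-- In each coordinate `m`, the order statistic of the pair `w m` that `i m` selects. -/
noncomputable def orderStatVector {d : ℕ} (i : Fin d → Fin 2) (w : Fin d → ℝ × ℝ) : Fin d → ℝ :=
  fun m => orderStat (i m) (w m)

theorem measurable_orderStatVector {d : ℕ} (i : Fin d → Fin 2) :
    Measurable (orderStatVector i) :=
  measurable_pi_lambda _ fun m => (measurable_orderStat (i m)).comp (measurable_pi_apply m)

/-- The law of `d` independent pairs, the `m`-th one consisting of two independent copies of
`μ m`. -/
noncomputable def pairLaw {d : ℕ} (μ : Fin d → Measure ℝ) : Measure (Fin d → ℝ × ℝ) :=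
  Measure.pi fun m => (μ m).prod (μ m)

/-- The mixture, with weights `p i` on `{0,1}^d`, of the laws of `orderStatVector i` for independent
pairs. The weights enter through `ENNReal.ofReal`, so they are meant to be nonnegative. -/
noncomputable def orderStatMixture {d : ℕ} (μ : Fin d → Measure ℝ)
    (p : (Fin d → Fin 2) → ℝ) : Measure (Fin d → ℝ) :=
  Measure.sum fun i => ENNReal.ofReal (p i) • (pairLaw μ).map (orderStatVector i)

/-- The FGM copula is the mixture, with the weights of the corresponding symmetric Bernoulli vector,
of products of cdfs of minima and maxima: summing over `i` coordinate by coordinate, the factor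
`(-1)^{i m}` kills the constant and picks the coefficient `1 - u m` for `m ∈ A`, and conversely for
`m ∉ A`. -/
theorem fgmCopula_eq_sum {d : ℕ} (θ : Finset (Fin d) → ℝ) (u : Fin d → ℝ) :
    fgmCopula θ u = ∑ i : Fin d → Fin 2,
      fgmBernoulliPmf θ i * ∏ m, (u m * (1 + (-1) ^ (i m : ℕ) * (1 - u m))) := by
  have key : ∀ A : Finset (Fin d), ∑ i : Fin d → Fin 2, (-1 : ℝ) ^ (∑ j ∈ A, (i j : ℕ)) *
      ∏ m, (u m * (1 + (-1) ^ (i m : ℕ) * (1 - u m))) =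
      2 ^ d * ((∏ m, u m) * ∏ j ∈ A, (1 - u j)) := by
    intro A
    have h1 : ∀ i : Fin d → Fin 2, (-1 : ℝ) ^ (∑ j ∈ A, (i j : ℕ)) *
        ∏ m, (u m * (1 + (-1) ^ (i m : ℕ) * (1 - u m))) =
        ∏ m, ((if m ∈ A then (-1 : ℝ) ^ (i m : ℕ) else 1) *
          (u m * (1 + (-1) ^ (i m : ℕ) * (1 - u m)))) := by
      intro i
      rw [Finset.prod_mul_distrib (f := fun m => if m ∈ A then (-1 : ℝ) ^ (i m : ℕ) else 1),
        Finset.prod_ite_mem, Finset.univ_inter, Finset.prod_pow_eq_pow_sum]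
    have h2 : ∏ j ∈ A, (1 - u j) = ∏ m, if m ∈ A then 1 - u m else 1 := by
      rw [Finset.prod_ite_mem, Finset.univ_inter]
    have h3 : (2 : ℝ) ^ d = ∏ _m : Fin d, (2 : ℝ) := by simp
    rw [Finset.sum_congr rfl fun i _ => h1 i, h2, h3, ← Finset.prod_mul_distrib,
      ← Finset.prod_mul_distrib, ← Fintype.prod_sum (fun (m : Fin d) (b : Fin 2) =>
        (if m ∈ A then (-1 : ℝ) ^ (b : ℕ) else 1) * (u m * (1 + (-1) ^ (b : ℕ) * (1 - u m))))]
    refine Finset.prod_congr rfl fun m _ => ?_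
    rw [Fin.sum_univ_two]
    split_ifs <;> simp <;> ring
  have h0 := key ∅
  simp only [Finset.sum_empty, pow_zero, one_mul, Finset.prod_empty, mul_one] at h0
  have hd : (2 : ℝ) ^ d ≠ 0 := by positivity
  have hpmf : ∀ i : Fin d → Fin 2,
      fgmBernoulliPmf θ i * ∏ m, (u m * (1 + (-1) ^ (i m : ℕ) * (1 - u m))) =
      1 / 2 ^ d * (∏ m, (u m * (1 + (-1) ^ (i m : ℕ) * (1 - u m))) +
        ∑ A : Finset (Fin d) with 2 ≤ A.card, θ A * ((-1) ^ (∑ j ∈ A, (i j : ℕ)) *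
          ∏ m, (u m * (1 + (-1) ^ (i m : ℕ) * (1 - u m))))) := by
    intro i
    rw [fgmBernoulliPmf, mul_assoc, add_mul, one_mul, Finset.sum_mul]
    congr 2
    exact Finset.sum_congr rfl fun A _ => by ring
  rw [Finset.sum_congr rfl fun i _ => hpmf i, ← Finset.mul_sum, Finset.sum_add_distrib, h0,
    Finset.sum_comm]
  simp only [← Finset.mul_sum, key]
  rw [fgmCopula, fgmPoly, mul_add, mul_add, mul_one, Finset.mul_sum, Finset.mul_sum]
  congr 1
  · field_simp
  · refine Finset.sum_congr rfl fun A _ => ?_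
    field_simp

/-- A random vector with an FGM copula has the law of a random choice, by the corresponding
symmetric Bernoulli vector, between minima and maxima of independent pairs. -/
theorem map_eq_orderStatMixture {Ω : Type*} [MeasurableSpace Ω] {P : Measure Ω}
    [IsProbabilityMeasure P] {d : ℕ} {V : Ω → Fin d → ℝ} (hV : Measurable V)
    {θ : Finset (Fin d) → ℝ} (hθ : HasCopula P V (fgmCopula θ))
    (hp : ∀ i, 0 ≤ fgmBernoulliPmf θ i) :
    P.map V = orderStatMixture (fun m => P.map fun ω => V ω m) (fgmBernoulliPmf θ) := by
  have hVm : ∀ m, Measurable fun ω => V ω m := fun m => (measurable_pi_apply m).comp hV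
  have hprob : ∀ m, IsProbabilityMeasure (P.map fun ω => V ω m) := fun m =>
    Measure.isProbabilityMeasure_map (hVm m).aemeasurable
  have : IsProbabilityMeasure (P.map V) := Measure.isProbabilityMeasure_map hV.aemeasurable
  refine measure_pi_ext_of_Iic fun x => ?_
  have hmeas : MeasurableSet (Set.univ.pi fun m => Set.Iic (x m)) :=
    MeasurableSet.univ_pi fun _ => measurableSet_Iic
  have hpre : V ⁻¹' (Set.univ.pi fun m => Set.Iic (x m)) = {ω | ∀ i, V ω i ≤ x i} := by
    ext ω; simp [Pi.le_def]
  rw [Measure.map_apply hV hmeas, hpre, ← ofReal_measureReal, hθ x, fgmCopula_eq_sum,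
    orderStatMixture, Measure.sum_apply _ hmeas, tsum_fintype]
  have hmarg : ∀ m, P.real {ω | V ω m ≤ x m} = (P.map fun ω => V ω m).real (Set.Iic (x m)) := by
    intro m
    rw [map_measureReal_apply (hVm m) measurableSet_Iic]
    rfl
  have hterm : ∀ i : Fin d → Fin 2,
      (pairLaw fun m => P.map fun ω => V ω m).map (orderStatVector i)
        (Set.univ.pi fun m => Set.Iic (x m)) =
      ENNReal.ofReal (∏ m, (P.real {ω | V ω m ≤ x m} *
        (1 + (-1) ^ (i m : ℕ) * (1 - P.real {ω | V ω m ≤ x m})))) := by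
    intro i
    have hs : orderStatVector i ⁻¹' (Set.univ.pi fun m => Set.Iic (x m)) =
        Set.univ.pi fun m => {w : ℝ × ℝ | orderStat (i m) w ≤ x m} := by
      ext w; simp [orderStatVector, Pi.le_def]
    rw [Measure.map_apply (measurable_orderStatVector i) hmeas, hs, pairLaw, Measure.pi_pi]
    simp only [hmarg, ← prod_orderStat_le]
    rw [ENNReal.ofReal_prod_of_nonneg fun _ _ => measureReal_nonneg]
    exact Finset.prod_congr rfl fun m _ => (ofReal_measureReal).symm
  have hnonneg : ∀ i : Fin d → Fin 2, 0 ≤ ∏ m, (P.real {ω | V ω m ≤ x m} *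
      (1 + (-1) ^ (i m : ℕ) * (1 - P.real {ω | V ω m ≤ x m}))) := by
    intro i
    refine Finset.prod_nonneg fun m _ => ?_
    rw [hmarg, ← prod_orderStat_le]
    exact measureReal_nonneg
  rw [ENNReal.ofReal_sum_of_nonneg fun i _ => mul_nonneg (hp i) (hnonneg i)]
  refine Finset.sum_congr rfl fun i _ => ?_
  rw [ENNReal.ofReal_mul (hp i), Measure.smul_apply, hterm, smul_eq_mul]
/-! ### Supermodular functions -/

theorem supermodular_comp_affine {d : ℕ} {φ : (Fin d → ℝ) → ℝ} (hφ : Supermodular φ)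
    (a c : Fin d → ℝ) (hc : ∀ m, 0 ≤ c m) : Supermodular fun x => φ (a + c * x) := by
  intro x i j hij ε δ hε hδ
  have hs : ∀ (y : Fin d → ℝ) (m : Fin d) (r : ℝ),
      a + c * (y + Pi.single m r) = a + c * y + Pi.single m (c m * r) := by
    intro y m r
    rw [mul_add, ← add_assoc]
    congr 1
    ext l
    by_cases h : l = m
    · subst h; simp
    · simp [h]
  simp only [hs]
  rcases (hc i).eq_or_lt with hi | hi
  · simp [← hi]
  rcases (hc j).eq_or_lt with hj | hj
  · simp [← hj]
  exact hφ _ i j hij _ _ (mul_pos hi hε) (mul_pos hj hδ)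

theorem supermodular_convex_comp {d : ℕ} {ψ : (Fin d → ℝ) → ℝ} (hψ : Supermodular ψ)
    (hmono : Monotone ψ) {φ : ℝ → ℝ} (hφ : Monotone φ) (hconv : ConvexOn ℝ Set.univ φ) :
    Supermodular fun x => φ (ψ x) := by
  intro x i j hij ε δ hε hδ
  have h := hψ x i j hij ε δ hε hδ
  have hle : ∀ (y : Fin d → ℝ) (m : Fin d) {r : ℝ}, 0 < r → y ≤ y + Pi.single m r :=
    fun y m r hr => le_add_of_nonneg_right (Pi.single_nonneg.2 hr.le)
  have hA := hmono (hle x j hδ)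
  have hB := hmono (hle x i hε)
  set A := ψ x
  set B := ψ (x + Pi.single j δ)
  set C := ψ (x + Pi.single i ε)
  set D := ψ (x + Pi.single i ε + Pi.single j δ)
  have hD : φ (B + C - A) ≤ φ D := hφ (by linarith)
  -- `B` and `C` are convex combinations of `A` and `B + C - A`, with the two weights swapped.
  suffices φ B + φ C ≤ φ A + φ (B + C - A) by
    change φ B - φ A ≤ φ D - φ C
    linarith
  rcases (show 0 ≤ (B - A) + (C - A) by linarith).eq_or_lt with h0 | h0
  · rw [show B = A by linarith, show C = A by linarith, show A + A - A = A by ring]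
  have hs : (C - A) / ((B - A) + (C - A)) + (B - A) / ((B - A) + (C - A)) = 1 := by
    field_simp; ring
  have e1 := hconv.2 (Set.mem_univ A) (Set.mem_univ (B + C - A))
    (div_nonneg (sub_nonneg.2 hB) h0.le) (div_nonneg (sub_nonneg.2 hA) h0.le) hs
  have e2 := hconv.2 (Set.mem_univ A) (Set.mem_univ (B + C - A))
    (div_nonneg (sub_nonneg.2 hA) h0.le) (div_nonneg (sub_nonneg.2 hB) h0.le)
    ((add_comm _ _).trans hs)
  simp only [smul_eq_mul] at e1 e2
  rw [show (C - A) / ((B - A) + (C - A)) * A + (B - A) / ((B - A) + (C - A)) * (B + C - A) = B by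
    field_simp; ring] at e1
  rw [show (B - A) / ((B - A) + (C - A)) * A + (C - A) / ((B - A) + (C - A)) * (B + C - A) = C by
    field_simp; ring] at e2
  generalize (C - A) / ((B - A) + (C - A)) = s at *
  generalize (B - A) / ((B - A) + (C - A)) = t at *
  obtain rfl : s = 1 - t := by linarith
  linarith

/-- The sum of the first `min N k` claim amounts as a function of `v = (N, X_1, …, X_k)`. The claim
amounts are replaced by their positive parts, which makes the function monotone and supermodular on
all of `ℝ^(k+1)` and does not matter for positive amounts. -/
noncomputable def truncatedAggregate (k : ℕ) (v : Fin (k + 1) → ℝ) : ℝ :=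
  ∑ j : Fin k, if ((j : ℕ) : ℝ) + 1 ≤ v 0 then max (v j.succ) 0 else 0

/-- Each summand involves only the coordinates `0` and `j + 1`, and its increment in the coordinate
`j + 1` is zero below the threshold `j + 1` of the coordinate `0` and nonnegative above it. -/
theorem supermodular_truncatedAggregate (k : ℕ) : Supermodular (truncatedAggregate k) := by
  intro x i l hil ε δ hε hδ
  simp only [truncatedAggregate, ← Finset.sum_sub_distrib]
  refine Finset.sum_le_sum fun j _ => ?_
  have hl : l ≠ 0 := (Fin.pos_iff_ne_zero.1 ((Fin.zero_le i).trans_lt hil))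
  rcases eq_or_ne l j.succ with rfl | hlj
  · have hi : j.succ ≠ i := hil.ne'
    rcases eq_or_ne i 0 with rfl | hi0
    · have h1 : max (x j.succ) 0 ≤ max (x j.succ + δ) 0 := max_le_max_right _ (by linarith)
      simp only [Pi.add_apply, Pi.single_eq_same, Pi.single_eq_of_ne hl.symm,
        Pi.single_eq_of_ne hl, add_zero]
      split_ifs <;> linarith
    · simp [Pi.single_eq_of_ne hi, Pi.single_eq_of_ne hi0.symm]
  · simp [Pi.single_eq_of_ne hlj.symm, Pi.single_eq_of_ne hl.symm]

theorem monotone_truncatedAggregate (k : ℕ) : Monotone (truncatedAggregate k) := by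
  intro x y hxy
  refine Finset.sum_le_sum fun j _ => ?_
  have h0 := hxy 0
  have h1 : max (x j.succ) 0 ≤ max (y j.succ) 0 := max_le_max_right _ (hxy _)
  have h2 := le_max_right (x j.succ) 0
  split_ifs <;> linarith

theorem measurable_truncatedAggregate (k : ℕ) : Measurable (truncatedAggregate k) := by
  refine Finset.measurable_sum _ fun j _ => Measurable.ite ?_ ?_ measurable_const
  · exact measurableSet_le measurable_const (measurable_pi_apply 0)
  · exact (measurable_pi_apply _).max measurable_const

theorem truncatedAggregate_crmVector {Ω : Type*} (N : Ω → ℕ) (X : ℕ → Ω → ℝ) (k : ℕ) (ω : Ω) :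
    truncatedAggregate k (crmVector N X k ω) =
      ∑ j ∈ Finset.range k, if j < N ω then max (X j ω) 0 else 0 := by
  rw [Finset.sum_range]
  refine Finset.sum_congr rfl fun j _ => ?_
  simp only [crmVector, Fin.cons_zero, Fin.cons_succ, ← Nat.cast_add_one, Nat.cast_le,
    Nat.succ_le_iff]

theorem truncatedAggregate_crmVector_eq {Ω : Type*} (N : Ω → ℕ) (X : ℕ → Ω → ℝ) (k : ℕ) {ω : Ω}
    (hX : ∀ j, 0 < X j ω) :
    truncatedAggregate k (crmVector N X k ω) = ∑ j ∈ Finset.range (min k (N ω)), X j ω := by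
  have : Finset.range (min k (N ω)) = (Finset.range k).filter (· < N ω) := by
    ext j; simp
  rw [truncatedAggregate_crmVector, this, Finset.sum_filter]
  simp only [max_eq_left (hX _).le]

/-! ### Laws of symmetric Bernoulli vectors -/

theorem map_initialVector {Ω : Type*} [MeasurableSpace Ω] {Q : Measure Ω}
    [IsProbabilityMeasure Q] {I : ℕ → Ω → ℝ} (hI : IsSymmBernoulliSeq Q I) (k : ℕ) :
    Q.map (initialVector I k) = Measure.sum fun i : Fin (k + 1) → Fin 2 =>
      ENNReal.ofReal (Q.real {ω | ∀ j, initialVector I k ω j = ((i j : ℕ) : ℝ)}) •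
        Measure.dirac fun j => ((i j : ℕ) : ℝ) := by
  have hm : Measurable (initialVector I k) := measurable_pi_lambda _ fun j => hI.measurable j
  have hm' : ∀ i : Fin (k + 1) → Fin 2,
      MeasurableSet {ω | ∀ j, initialVector I k ω j = ((i j : ℕ) : ℝ)} := fun i => by
    rw [Set.ofPred_forall]
    exact MeasurableSet.iInter fun j => measurableSet_eq_fun (hI.measurable j) measurable_const
  have hae : ∀ᵐ ω ∂Q, ∀ j, I j ω = 0 ∨ I j ω = 1 := by
    refine ae_all_iff.2 fun j => ?_
    have h0 : MeasurableSet {ω | I j ω = 0} := hI.measurable j (measurableSet_singleton 0)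
    have h1 : MeasurableSet {ω | I j ω = 1} := hI.measurable j (measurableSet_singleton 1)
    refine (prob_compl_eq_zero_iff (h0.union h1)).2 ?_
    rw [← ENNReal.toReal_eq_one_iff]
    change Q.real _ = 1
    rw [measureReal_union _ h1, hI.prob_zero, hI.prob_one]
    · norm_num
    · refine Set.disjoint_left.2 fun ω h h' => ?_
      exact zero_ne_one (h.symm.trans h')
  ext s hs
  rw [Measure.map_apply hm hs, Measure.sum_apply _ hs, tsum_fintype]
  have hdisj : Pairwise (Function.onFun Disjoint fun i : Fin (k + 1) → Fin 2 =>
      initialVector I k ⁻¹' s ∩ {ω | ∀ j, initialVector I k ω j = ((i j : ℕ) : ℝ)}) := by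
    intro i i' hii
    refine Set.disjoint_left.2 fun ω h h' => hii (funext fun j => ?_)
    exact Fin.ext (Nat.cast_injective (R := ℝ) ((h.2 j).symm.trans (h'.2 j)))
  have hunion : Q (initialVector I k ⁻¹' s) = Q (⋃ i : Fin (k + 1) → Fin 2,
      initialVector I k ⁻¹' s ∩ {ω | ∀ j, initialVector I k ω j = ((i j : ℕ) : ℝ)}) := by
    refine measure_congr ?_
    filter_upwards [hae] with ω hω
    refine propext ⟨fun h => ?_, fun h => ?_⟩
    · refine Set.mem_iUnion.2 ⟨fun j => if I j ω = 0 then 0 else 1, h, fun j => ?_⟩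
      rcases hω j with h | h <;> simp [initialVector, h]
    · obtain ⟨i, hi⟩ := Set.mem_iUnion.1 h
      exact hi.1
  rw [hunion, measure_iUnion hdisj fun i => (hm hs).inter (hm' i), tsum_fintype]
  refine Finset.sum_congr rfl fun i _ => ?_
  rw [Measure.smul_apply, Measure.dirac_apply' _ hs, ofReal_measureReal, smul_eq_mul]
  by_cases h : (fun j => ((i j : ℕ) : ℝ)) ∈ s
  · rw [Set.indicator_of_mem h, Pi.one_apply, mul_one]
    congr 1
    refine Set.inter_eq_right.2 fun ω hω => ?_
    change initialVector I k ω ∈ s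
    rwa [show initialVector I k ω = _ from funext hω]
  · rw [Set.indicator_of_notMem h, mul_zero]
    convert measure_empty (μ := Q)
    refine Set.eq_empty_of_forall_notMem fun ω hω => h ?_
    have h1 : initialVector I k ω ∈ s := hω.1
    rwa [show initialVector I k ω = _ from funext hω.2] at h1

/-- Under a finite mixture of point masses, every function has an expectation, measurable or not. -/
theorem expectation_sum_dirac {α ι : Type*} [MeasurableSpace α] [MeasurableSingletonClass α]
    [Fintype ι] (p : ι → ℝ) (hp : ∀ i, 0 ≤ p i) (x : ι → α) (f : α → ℝ) :
    HasExpectation (Measure.sum fun i => ENNReal.ofReal (p i) • Measure.dirac (x i)) f ∧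
    expectation (Measure.sum fun i => ENNReal.ofReal (p i) • Measure.dirac (x i)) f =
      ((∑ i, p i * f (x i) : ℝ) : EReal) := by
  have h : ∀ g : α → ℝ, ∫⁻ y, ENNReal.ofReal (g y)
      ∂(Measure.sum fun i => ENNReal.ofReal (p i) • Measure.dirac (x i)) =
      ENNReal.ofReal (∑ i, p i * max (g (x i)) 0) := by
    intro g
    rw [lintegral_sum_measure, tsum_fintype,
      ENNReal.ofReal_sum_of_nonneg fun i _ => mul_nonneg (hp i) (le_max_right _ _)]
    refine Finset.sum_congr rfl fun i _ => ?_
    rw [lintegral_smul_measure, lintegral_dirac, ENNReal.ofReal_mul (hp i), smul_eq_mul]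
    simp [ENNReal.ofReal_max]
  refine ⟨⟨?_, Or.inl ?_⟩, ?_⟩
  · exact aemeasurable_sum_measure_iff.2 fun i => aemeasurable_dirac.smul_measure _
  · rw [h]; exact ENNReal.ofReal_ne_top
  · have hn : ∀ g : α → ℝ, 0 ≤ ∑ i, p i * max (g (x i)) 0 := fun g =>
      Finset.sum_nonneg fun i _ => mul_nonneg (hp i) (le_max_right _ _)
    rw [expectation, h f, h fun y => -f y, EReal.coe_ennreal_ofReal, EReal.coe_ennreal_ofReal,
      max_eq_left (hn f), max_eq_left (hn fun y => -f y), ← EReal.coe_sub,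
      ← Finset.sum_sub_distrib]
    congr 1
    refine Finset.sum_congr rfl fun i _ => ?_
    rw [← mul_sub, max_zero_sub_max_neg_zero_eq_self]

/-! ### Transfer of the supermodular order -/

/-- Integrals under a mixture are integrals over the pairs. The function `f` need only be a.e.
measurable for the components of nonzero weight, since the others do not contribute. -/
theorem lintegral_orderStatMixture {d : ℕ} {μ : Fin d → Measure ℝ} {p : (Fin d → Fin 2) → ℝ}
    {f : (Fin d → ℝ) → ENNReal} (hf : AEMeasurable f (orderStatMixture μ p)) :
    AEMeasurable (fun w => ∑ i, ENNReal.ofReal (p i) * f (orderStatVector i w)) (pairLaw μ) ∧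
    ∫⁻ x, f x ∂orderStatMixture μ p =
      ∫⁻ w, ∑ i, ENNReal.ofReal (p i) * f (orderStatVector i w) ∂pairLaw μ := by
  have hT := fun i : Fin d → Fin 2 => measurable_orderStatVector i
  have hfi : ∀ i, ENNReal.ofReal (p i) ≠ 0 →
      AEMeasurable f ((pairLaw μ).map (orderStatVector i)) := by
    intro i hi
    have h := aemeasurable_sum_measure_iff.1 hf i
    exact h.mono_ac (Measure.absolutelyContinuous_smul hi)
  have hterm : ∀ i, AEMeasurable (fun w => ENNReal.ofReal (p i) * f (orderStatVector i w))
      (pairLaw μ) := by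
    intro i
    by_cases hi : ENNReal.ofReal (p i) = 0
    · simp only [hi, zero_mul]
      exact aemeasurable_const
    · exact ((hfi i hi).comp_measurable (hT i)).const_mul _
  refine ⟨Finset.aemeasurable_fun_sum _ fun i _ => hterm i, ?_⟩
  rw [orderStatMixture, lintegral_sum_measure, tsum_fintype,
    lintegral_finsetSum' _ fun i _ => hterm i]
  refine Finset.sum_congr rfl fun i _ => ?_
  rw [lintegral_smul_measure, lintegral_const_mul' _ _ ENNReal.ofReal_ne_top, smul_eq_mul]
  by_cases hi : ENNReal.ofReal (p i) = 0
  · simp [hi]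
  · rw [lintegral_map' (hfi i hi) (hT i).aemeasurable]

/-- A weighted inequality, with positive and negative parts on the sides where they are
nonnegative. -/
theorem sum_ofReal_le_of_sum_mul_le {ι : Type*} [Fintype ι] {p q : ι → ℝ} (hp : ∀ i, 0 ≤ p i)
    (hq : ∀ i, 0 ≤ q i) {h : ι → ℝ} (hle : ∑ i, p i * h i ≤ ∑ i, q i * h i) :
    ∑ i, ENNReal.ofReal (p i) * ENNReal.ofReal (h i) +
        ∑ i, ENNReal.ofReal (q i) * ENNReal.ofReal (-h i) ≤
      ∑ i, ENNReal.ofReal (q i) * ENNReal.ofReal (h i) +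
        ∑ i, ENNReal.ofReal (p i) * ENNReal.ofReal (-h i) := by
  have key : ∀ r : ι → ℝ, (∀ i, 0 ≤ r i) → ∀ g : ι → ℝ,
      ∑ i, ENNReal.ofReal (r i) * ENNReal.ofReal (g i) =
        ENNReal.ofReal (∑ i, r i * max (g i) 0) ∧ 0 ≤ ∑ i, r i * max (g i) 0 := by
    intro r hr g
    have hn : ∀ i, 0 ≤ r i * max (g i) 0 := fun i => mul_nonneg (hr i) (le_max_right _ _)
    refine ⟨?_, Finset.sum_nonneg fun i _ => hn i⟩
    rw [ENNReal.ofReal_sum_of_nonneg fun i _ => hn i]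
    refine Finset.sum_congr rfl fun i _ => ?_
    rw [ENNReal.ofReal_mul (hr i)]
    simp [ENNReal.ofReal_max]
  have hsplit : ∀ r : ι → ℝ,
      ∑ i, r i * h i = ∑ i, r i * max (h i) 0 - ∑ i, r i * max (-h i) 0 := by
    intro r
    rw [← Finset.sum_sub_distrib]
    refine Finset.sum_congr rfl fun i _ => ?_
    rw [← mul_sub, max_zero_sub_max_neg_zero_eq_self]
  rw [hsplit p, hsplit q] at hle
  rw [(key p hp h).1, (key q hq h).1, (key p hp fun i => -h i).1, (key q hq fun i => -h i).1,
    ← ENNReal.ofReal_add (key p hp h).2 (key q hq _).2,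
    ← ENNReal.ofReal_add (key q hq h).2 (key p hp _).2]
  exact ENNReal.ofReal_le_ofReal (by linarith)

/-- The inequality of weighted sums holds pointwise in the pairs `w`: the values
`φ (orderStatVector i w)` are those at `i` of the supermodular function `x ↦ φ (a + (b - a) * x)`,
with `a ≤ b` the vectors of minima and maxima. -/
theorem smOrder_orderStatMixture {d : ℕ} (μ : Fin d → Measure ℝ) {p q : (Fin d → Fin 2) → ℝ}
    (hp : ∀ i, 0 ≤ p i) (hq : ∀ i, 0 ≤ q i)
    (h : ∀ ψ : (Fin d → ℝ) → ℝ, Supermodular ψ →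
      ∑ i, p i * ψ (fun m => ((i m : ℕ) : ℝ)) ≤ ∑ i, q i * ψ (fun m => ((i m : ℕ) : ℝ))) :
    SMOrder (orderStatMixture μ p) (orderStatMixture μ q) := by
  intro φ hφ hEp hEq
  refine EReal.coe_ennreal_sub_le_sub ?_ hEq.2
  have hpos := lintegral_orderStatMixture hEp.1.ennreal_ofReal
  have hneg := lintegral_orderStatMixture hEp.1.neg.ennreal_ofReal
  have hpos' := lintegral_orderStatMixture hEq.1.ennreal_ofReal
  have hneg' := lintegral_orderStatMixture hEq.1.neg.ennreal_ofReal
  simp only [Pi.neg_apply] at hneg hneg'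
  rw [hpos.2, hneg.2, hpos'.2, hneg'.2, ← lintegral_add_left' hpos.1,
    ← lintegral_add_left' hpos'.1]
  refine lintegral_mono fun w => sum_ofReal_le_of_sum_mul_le hp hq ?_
  have hψ := h _ (supermodular_comp_affine hφ (fun m => min (w m).1 (w m).2)
    (fun m => max (w m).1 (w m).2 - min (w m).1 (w m).2)
    fun m => sub_nonneg.2 min_le_max)
  have hsel : ∀ i : Fin d → Fin 2, (fun m => min (w m).1 (w m).2) +
      (fun m => max (w m).1 (w m).2 - min (w m).1 (w m).2) * (fun m => ((i m : ℕ) : ℝ)) =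
      orderStatVector i w := by
    intro i
    ext m
    simp only [Pi.add_apply, Pi.mul_apply, orderStatVector, orderStat]
    rcases Fin.exists_fin_two.1 ⟨i m, rfl⟩ with h | h <;> simp [h]
  simpa only [hsel] using hψ

/-- The supermodular order between Bernoulli vectors in terms of finite sums. -/
theorem sum_bernoulli_le {Ω Ωd : Type*} [MeasurableSpace Ω] [MeasurableSpace Ωd]
    {Q : Measure Ω} {Qd : Measure Ωd} [IsProbabilityMeasure Q] [IsProbabilityMeasure Qd]
    {I : ℕ → Ω → ℝ} {Id : ℕ → Ωd → ℝ} (hI : IsSymmBernoulliSeq Q I)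
    (hId : IsSymmBernoulliSeq Qd Id) {k : ℕ}
    (h : SMOrder (Q.map (initialVector I k)) (Qd.map (initialVector Id k)))
    {ψ : (Fin (k + 1) → ℝ) → ℝ} (hψ : Supermodular ψ) :
    ∑ i : Fin (k + 1) → Fin 2, Q.real {ω | ∀ j, initialVector I k ω j = ((i j : ℕ) : ℝ)} *
        ψ (fun m => ((i m : ℕ) : ℝ)) ≤
      ∑ i : Fin (k + 1) → Fin 2, Qd.real {ω | ∀ j, initialVector Id k ω j = ((i j : ℕ) : ℝ)} *
        ψ (fun m => ((i m : ℕ) : ℝ)) := by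
  rw [map_initialVector hI, map_initialVector hId] at h
  have e := expectation_sum_dirac
    (fun i : Fin (k + 1) → Fin 2 => Q.real {ω | ∀ j, initialVector I k ω j = ((i j : ℕ) : ℝ)})
    (fun _ => measureReal_nonneg) (fun i j => ((i j : ℕ) : ℝ)) ψ
  have ed := expectation_sum_dirac
    (fun i : Fin (k + 1) → Fin 2 => Qd.real {ω | ∀ j, initialVector Id k ω j = ((i j : ℕ) : ℝ)})
    (fun _ => measureReal_nonneg) (fun i j => ((i j : ℕ) : ℝ)) ψ
  have := h ψ hψ e.1 ed.1
  rw [e.2, ed.2] at this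
  exact EReal.coe_le_coe_iff.1 this

/-! ### Collective risk models -/

theorem crmVector_zero {Ω : Type*} (N : Ω → ℕ) (X : ℕ → Ω → ℝ) :
    crmVector N X 0 = (fun (n : ℕ) (_ : Fin 1) => (n : ℝ)) ∘ N := by
  ext ω j
  rw [Fin.fin_one_eq_zero j]
  rfl

theorem measurable_crmVector {Ω : Type*} [MeasurableSpace Ω] {P : Measure Ω} {N : Ω → ℕ}
    {X : ℕ → Ω → ℝ} (h : IsCRM P N X) (k : ℕ) : Measurable (crmVector N X k) := by
  refine measurable_pi_lambda _ fun j => ?_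
  refine Fin.cases ?_ (fun j => ?_) j
  · exact (measurable_of_countable (fun n : ℕ => (n : ℝ))).comp h.measurable_count
  · exact h.measurable_amount j

theorem measurable_aggregateClaim {Ω : Type*} [MeasurableSpace Ω] {P : Measure Ω} {N : Ω → ℕ}
    {X : ℕ → Ω → ℝ} (h : IsCRM P N X) : Measurable (aggregateClaim N X) := by
  have : Measurable fun z : ℕ × Ω => ∑ j ∈ Finset.range z.1, X j z.2 :=
    measurable_from_prod_countable_right fun n =>
      Finset.measurable_fun_sum (Finset.range n) fun j _ => h.measurable_amount j
  exact this.comp (h.measurable_count.prodMk measurable_id)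

section

variable {Ω Ωd Ω' Ωd' : Type*} [MeasurableSpace Ω] [MeasurableSpace Ωd]
    [MeasurableSpace Ω'] [MeasurableSpace Ωd']
    {P : Measure Ω} {Pd : Measure Ωd} {Q : Measure Ω'} {Qd : Measure Ωd'}
    {N : Ω → ℕ} {X : ℕ → Ω → ℝ} {I : ℕ → Ω' → ℝ}
    {Nd : Ωd → ℕ} {Xd : ℕ → Ωd → ℝ} {Id : ℕ → Ωd' → ℝ}

theorem inSupport_iff (hN : IdentDistrib N Nd P Pd) (n : ℕ) :
    InSupport P N n ↔ InSupport Pd Nd n := by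
  have := hN.measure_mem_eq (measurableSet_singleton n)
  change P {ω | N ω = n} = Pd {ω | Nd ω = n} at this
  rw [InSupport, InSupport, this]

theorem map_crmVector_apply_eq (hcrm : IsCRM P N X) (hcrmd : IsCRM Pd Nd Xd)
    (hN : IdentDistrib N Nd P Pd) (hX : IdentDistrib (X 0) (Xd 0) P Pd) (k : ℕ)
    (m : Fin (k + 1)) :
    (P.map fun ω => crmVector N X k ω m) = Pd.map fun ω => crmVector Nd Xd k ω m := by
  refine Fin.cases ?_ (fun j => ?_) m
  · exact (hN.comp (measurable_of_countable (fun n : ℕ => (n : ℝ)))).map_eq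
  · exact (((hcrm.identDistrib j 0).trans hX).trans (hcrmd.identDistrib 0 j)).map_eq

/-- The comparison of `(N, X_1, …, X_k)` for every `k` up to the supremum of the support of `N`,
whether or not `k` belongs to the support. -/
theorem smOrder_crmVector [IsProbabilityMeasure P] [IsProbabilityMeasure Pd]
    [IsProbabilityMeasure Q] [IsProbabilityMeasure Qd]
    (hcrm : IsFGMCRM P N X Q I) (hcrmd : IsFGMCRM Pd Nd Xd Qd Id)
    (hN : IdentDistrib N Nd P Pd) (hX : IdentDistrib (X 0) (Xd 0) P Pd)
    {k : ℕ} (hk : 1 ≤ k) (hsupp : ∃ n, k ≤ n ∧ InSupport P N n)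
    (hI : SMOrder (Q.map (initialVector I k)) (Qd.map (initialVector Id k))) :
    SMOrder (P.map (crmVector N X k)) (Pd.map (crmVector Nd Xd k)) := by
  obtain ⟨θ, -, hθ, hp⟩ := hcrm.fgm k hk hsupp
  obtain ⟨θd, -, hθd, hpd⟩ := hcrmd.fgm k hk
    (hsupp.imp fun n hn => ⟨hn.1, (inSupport_iff hN n).1 hn.2⟩)
  have hp0 : ∀ i, 0 ≤ fgmBernoulliPmf θ i := fun i => hp i ▸ measureReal_nonneg
  have hpd0 : ∀ i, 0 ≤ fgmBernoulliPmf θd i := fun i => hpd i ▸ measureReal_nonneg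
  rw [map_eq_orderStatMixture (measurable_crmVector hcrm.toIsCRM k) hθ hp0,
    map_eq_orderStatMixture (measurable_crmVector hcrmd.toIsCRM k) hθd hpd0]
  simp only [map_crmVector_apply_eq hcrm.toIsCRM hcrmd.toIsCRM hN hX]
  refine smOrder_orderStatMixture _ hp0 hpd0 fun ψ hψ => ?_
  simpa only [hp, hpd] using
    sum_bernoulli_le hcrm.toIsSymmBernoulliSeq hcrmd.toIsSymmBernoulliSeq hI hψ

end

/-! ### Aggregate claim amounts -/

theorem hasExpectation_of_nonneg {α : Type*} [MeasurableSpace α] {μ : Measure α} {f : α → ℝ}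
    (hf : Measurable f) (hf0 : ∀ x, 0 ≤ f x) : HasExpectation μ f := by
  refine ⟨hf.aemeasurable, Or.inr ?_⟩
  simp only [ENNReal.ofReal_of_nonpos (neg_nonpos.2 (hf0 _)), lintegral_zero]
  exact ENNReal.zero_ne_top

/-- For nonnegative functions, an inequality of expectations, which lives in `EReal`, can be read
back in `ENNReal`. -/
theorem lintegral_le_of_expectation_le {α : Type*} [MeasurableSpace α] {μ ν : Measure α}
    {f : α → ℝ} (hf : ∀ x, 0 ≤ f x) (h : expectation μ f ≤ expectation ν f) :
    ∫⁻ x, ENNReal.ofReal (f x) ∂μ ≤ ∫⁻ x, ENNReal.ofReal (f x) ∂ν := by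
  have hz : ∀ x, ENNReal.ofReal (-f x) = 0 := fun x =>
    ENNReal.ofReal_of_nonpos (neg_nonpos.2 (hf x))
  simpa [expectation, hz] using h

/-- Expectations of functions bounded below by `c` can be compared after subtraction of `c`. -/
theorem expectation_le_of_lintegral_sub_le {α : Type*} [MeasurableSpace α] {μ ν : Measure α}
    [IsProbabilityMeasure μ] [IsProbabilityMeasure ν] {f : α → ℝ} (hf : Measurable f) {c : ℝ}
    (hμ : ∀ᵐ x ∂μ, c ≤ f x) (hν : ∀ᵐ x ∂ν, c ≤ f x) (hE : HasExpectation ν f)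
    (h : ∫⁻ x, ENNReal.ofReal (f x - c) ∂μ ≤ ∫⁻ x, ENNReal.ofReal (f x - c) ∂ν) :
    expectation μ f ≤ expectation ν f := by
  have key : ∀ (ρ : Measure α) [IsProbabilityMeasure ρ], (∀ᵐ x ∂ρ, c ≤ f x) →
      ∫⁻ x, ENNReal.ofReal (f x - c) ∂ρ + ENNReal.ofReal c + ∫⁻ x, ENNReal.ofReal (-f x) ∂ρ =
        ∫⁻ x, ENNReal.ofReal (f x) ∂ρ + ENNReal.ofReal (-c) := by
    intro ρ _ hρ
    have hn : Measurable fun x => ENNReal.ofReal (-f x) := hf.neg.ennreal_ofReal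
    have hc : ∀ r : ENNReal, r = ∫⁻ _, r ∂ρ := fun r => by simp
    rw [hc (ENNReal.ofReal c), hc (ENNReal.ofReal (-c)), ← lintegral_add_right _ measurable_const,
      ← lintegral_add_right _ hn, ← lintegral_add_right _ measurable_const]
    refine lintegral_congr_ae ?_
    filter_upwards [hρ] with x hx
    have hm : ∀ r : ℝ, ENNReal.ofReal r = ENNReal.ofReal (max r 0) := fun r => by
      simp [ENNReal.ofReal_max]
    rw [hm c, hm (-f x), hm (f x), hm (-c), ← ENNReal.ofReal_add (sub_nonneg.2 hx) (by positivity),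
      ← ENNReal.ofReal_add (add_nonneg (sub_nonneg.2 hx) (by positivity)) (by positivity),
      ← ENNReal.ofReal_add (by positivity) (by positivity)]
    -- Both sides are `f⁺ + c⁻`, since `f - c = f⁺ - f⁻ - (c⁺ - c⁻)`.
    have h1 := max_zero_sub_max_neg_zero_eq_self c
    have h2 := max_zero_sub_max_neg_zero_eq_self (f x)
    congr 1
    linarith
  refine EReal.coe_ennreal_sub_le_sub ?_ hE.2
  have h1 := key μ hμ
  have h2 := key ν hν
  -- Cancelling the finite `c⁻` avoids any subtraction of possibly infinite integrals.
  refine (ENNReal.add_le_add_iff_right (ENNReal.ofReal_ne_top (r := -c))).1 ?_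
  calc _ = (∫⁻ x, ENNReal.ofReal (f x) ∂μ + ENNReal.ofReal (-c)) +
        ∫⁻ x, ENNReal.ofReal (-f x) ∂ν := by ring
    _ ≤ (∫⁻ x, ENNReal.ofReal (f x - c) ∂ν + ENNReal.ofReal c +
        ∫⁻ x, ENNReal.ofReal (-f x) ∂μ) + ∫⁻ x, ENNReal.ofReal (-f x) ∂ν := by
      rw [← h1]; gcongr
    _ = (∫⁻ x, ENNReal.ofReal (f x) ∂ν + ENNReal.ofReal (-c)) +
        ∫⁻ x, ENNReal.ofReal (-f x) ∂μ := by rw [← h2]; ring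
    _ = _ := by ring

theorem theorem6
    {Ω Ωd Ω' Ωd' : Type*} [MeasurableSpace Ω] [MeasurableSpace Ωd]
    [MeasurableSpace Ω'] [MeasurableSpace Ωd']
    (P : Measure Ω) (Pd : Measure Ωd) (Q : Measure Ω') (Qd : Measure Ωd')
    [IsProbabilityMeasure P] [IsProbabilityMeasure Pd]
    [IsProbabilityMeasure Q] [IsProbabilityMeasure Qd]
    (N : Ω → ℕ) (X : ℕ → Ω → ℝ) (I : ℕ → Ω' → ℝ)
    (Nd : Ωd → ℕ) (Xd : ℕ → Ωd → ℝ) (Id : ℕ → Ωd' → ℝ)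
    (hcrm : IsFGMCRM P N X Q I) (hcrmd : IsFGMCRM Pd Nd Xd Qd Id)
    (hN : IdentDistrib N Nd P Pd) (hX : IdentDistrib (X 0) (Xd 0) P Pd)
    (hI : ∀ k : ℕ, 1 ≤ k →
      SMOrder (Q.map (initialVector I k)) (Qd.map (initialVector Id k))) :
    (∀ k : ℕ, InSupport P N k →
      SMOrder (P.map (crmVector N X k)) (Pd.map (crmVector Nd Xd k))) ∧
    IcxOrder (P.map (aggregateClaim N X)) (Pd.map (aggregateClaim Nd Xd)) := by
  have hV := measurable_crmVector hcrm.toIsCRM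
  have hVd := measurable_crmVector hcrmd.toIsCRM
  have hS := measurable_aggregateClaim hcrm.toIsCRM
  have hSd := measurable_aggregateClaim hcrmd.toIsCRM
  refine ⟨fun k hk => ?_, fun φ hmono hconv hE hEd => ?_⟩
  · rcases Nat.eq_zero_or_pos k with rfl | hk0
    · -- `(N)` alone has the same law in both models; the copulas only enter for `k ≥ 1`.
      suffices P.map (crmVector N X 0) = Pd.map (crmVector Nd Xd 0) by
        rw [this]
        exact fun φ _ _ _ => le_rfl
      have hm : Measurable fun (n : ℕ) (_ : Fin 1) => (n : ℝ) :=
        measurable_of_countable _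
      rw [crmVector_zero, crmVector_zero]
      exact (hN.comp hm).map_eq
    · exact smOrder_crmVector hcrm hcrmd hN hX hk0 ⟨k, le_rfl, hk⟩ (hI k hk0)
  have hpos : ∀ᵐ ω ∂P, ∀ j, 0 < X j ω := ae_all_iff.2 hcrm.amount_pos
  have hposd : ∀ᵐ ω ∂Pd, ∀ j, 0 < Xd j ω := ae_all_iff.2 hcrmd.amount_pos
  have hφ : Measurable φ := hmono.measurable
  have := Measure.isProbabilityMeasure_map hS.aemeasurable (μ := P)
  have := Measure.isProbabilityMeasure_map hSd.aemeasurable (μ := Pd)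
  set g : ℝ → ENNReal := fun s => ENNReal.ofReal (φ s - φ 0) with hg
  have hgm : Measurable g := (hφ.sub_const _).ennreal_ofReal
  have hgmono : Monotone g := fun s t hst =>
    ENNReal.ofReal_le_ofReal (sub_le_sub_right (hmono hst) _)
  have hbound : ∀ k, ∫⁻ ω, g (truncatedAggregate k (crmVector N X k ω)) ∂P ≤
      ∫⁻ ω, g (aggregateClaim Nd Xd ω) ∂Pd := by
    intro k
    induction k with
    | zero => simp [truncatedAggregate, hg]
    | succ k ih =>
      by_cases hsupp : ∃ n, k + 1 ≤ n ∧ InSupport P N n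
      · have hsm := smOrder_crmVector hcrm hcrmd hN hX k.succ_pos hsupp (hI _ k.succ_pos)
        have hnn : ∀ v, 0 ≤ φ (truncatedAggregate (k + 1) v) - φ 0 := fun v =>
          sub_nonneg.2 (hmono (Finset.sum_nonneg fun j _ => by positivity))
        have hmeas : Measurable fun v => φ (truncatedAggregate (k + 1) v) - φ 0 :=
          (hφ.comp (measurable_truncatedAggregate _)).sub_const _
        have hsuper : Supermodular fun v => φ (truncatedAggregate (k + 1) v) - φ 0 :=
          supermodular_convex_comp (supermodular_truncatedAggregate _)
            (monotone_truncatedAggregate _) (φ := fun s => φ s - φ 0)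
            (fun s t hst => sub_le_sub_right (hmono hst) _) (hconv.add_const (-φ 0))
        have hle := lintegral_le_of_expectation_le hnn (hsm _ hsuper
          (hasExpectation_of_nonneg hmeas hnn) (hasExpectation_of_nonneg hmeas hnn))
        rw [lintegral_map hmeas.ennreal_ofReal (hV _),
          lintegral_map hmeas.ennreal_ofReal (hVd _)] at hle
        refine hle.trans (lintegral_mono_ae ?_)
        filter_upwards [hposd] with ω hω
        refine hgmono ?_
        rw [truncatedAggregate_crmVector_eq Nd Xd _ hω]
        exact Finset.sum_le_sum_of_subset_of_nonneg
          (Finset.range_subset_range.2 (min_le_right _ _)) fun j _ _ => (hω j).le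
      · -- Here `N ≤ k` almost surely, and the truncations at `k` and `k + 1` agree.
        refine (lintegral_mono_ae ?_).trans ih
        have hlt : ∀ᵐ ω ∂P, N ω ≤ k := by
          have : ∀ n, ∀ᵐ ω ∂P, k + 1 ≤ n → N ω ≠ n := by
            intro n
            by_cases hn : k + 1 ≤ n
            · have h0 : P {ω | N ω = n} = 0 := by
                by_contra h0
                exact hsupp ⟨n, hn, pos_iff_ne_zero.2 h0⟩
              filter_upwards [measure_eq_zero_iff_ae_notMem.1 h0] with ω hω _ using hω
            · exact Filter.Eventually.of_forall fun ω h => absurd h hn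
          filter_upwards [ae_all_iff.2 this] with ω hω
          by_contra! h
          exact hω (N ω) h rfl
        filter_upwards [hlt, hpos] with ω hω hω'
        rw [truncatedAggregate_crmVector_eq N X _ hω', truncatedAggregate_crmVector_eq N X _ hω',
          min_eq_right hω, min_eq_right (hω.trans k.le_succ)]
  refine expectation_le_of_lintegral_sub_le hφ (c := φ 0) ?_ ?_ hEd ?_
  · refine (ae_map_iff hS.aemeasurable (measurableSet_le measurable_const hφ)).2 ?_
    filter_upwards [hpos] with ω hω
    exact hmono (Finset.sum_nonneg fun j _ => (hω j).le)
  · refine (ae_map_iff hSd.aemeasurable (measurableSet_le measurable_const hφ)).2 ?_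
    filter_upwards [hposd] with ω hω
    exact hmono (Finset.sum_nonneg fun j _ => (hω j).le)
  · rw [lintegral_map hgm hS, lintegral_map hgm hSd]
    have hmon : Monotone fun k ω => g (truncatedAggregate k (crmVector N X k ω)) := by
      refine fun k l hkl ω => hgmono ?_
      simp only [truncatedAggregate_crmVector]
      exact Finset.sum_le_sum_of_subset_of_nonneg (Finset.range_subset_range.2 hkl)
        fun j _ _ => by positivity
    calc ∫⁻ ω, g (aggregateClaim N X ω) ∂P
        ≤ ∫⁻ ω, ⨆ k, g (truncatedAggregate k (crmVector N X k ω)) ∂P := by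
          refine lintegral_mono_ae ?_
          filter_upwards [hpos] with ω hω
          refine le_iSup_of_le (N ω) ?_
          rw [truncatedAggregate_crmVector_eq N X _ hω, min_self]
          rfl
      _ = ⨆ k, ∫⁻ ω, g (truncatedAggregate k (crmVector N X k ω)) ∂P :=
          lintegral_iSup (fun k => hgm.comp ((measurable_truncatedAggregate k).comp (hV k))) hmon
      _ ≤ ∫⁻ ω, g (aggregateClaim Nd Xd ω) ∂Pd := iSup_le hbound
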